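/- Let $M$ be a smooth manifold of dimension $n$ with tangent bundle $TM$, and let $\Psi$ be a metallic structure on $M$, that is, a smooth tensor field of type $(1,1)$ with $\Psi^2-\alpha\Psi-\beta I=0$, where $\alpha,\beta$ are positive integers. Let $\Psi^C$ be its complete lift, the tensor field of type $(1,1)$ on $TM$ which in the coordinates $(x^h,y^h)$ of $TM$ induced by coordinates $(x^h)$ of $M$ has the matrix $$\Psi^C=\begin{pmatrix}\Psi^h_i & 0\\ \partial\Psi^h_i & \Psi^h_i\end{pmatrix},\qquad \partial\Psi^h_i=y^k\,\partial_k\Psi^h_i .$$ Let $V$ be a smooth vector field on $M$, and let $\beta_V(M)\subset TM$ be the cross-section determined by $V$, i.e. the $n$-dimensional submanifold that is the image of $\beta_V:M\to TM$, $x\mapsto(x,V_x)$. Suppose that $\Psi^C$ leaves $\beta_V(M)$ invariant, i.e. that $\Psi^C$ maps every vector tangent to $\beta_V(M)$ to a vector tangent to $\beta_V(M)$, and let $\Psi^{C\#}$ be the tensor field of type $(1,1)$ induced on $\beta_V(M)$, i.e. the restriction of $\Psi^C$ to the vectors tangent to $\beta_V(M)$. For a tensor field $F$ of type $(1,1)$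 on a manifold, let $$N_F(X,Y)=[FX,FY]-F[FX,Y]-F[X,FY]+F^2[X,Y]$$ for vector fields $X,Y$ be its Nijenhuis tensor. Then $N_{\Psi^{C\#}}=0$ on $\beta_V(M)$ if and only if $N_\Psi=0$ on $M$. -/

import Mathlib

open scoped Manifold ContDiff Bundle
open VectorField

noncomputable section

/-! ### Smooth vector fields and tensor fields of type (1,1) -/

/-- The space of smooth vector fields on an `n`-dimensional manifold `M`. -/
abbrev SmoothVectorField (n : ℕ) (M : Type*) [TopologicalSpace M]
    [ChartedSpace (EuclideanSpace ℝ (Fin n)) M] [IsManifold (𝓡 n) ∞ M] : Type _ :=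
  Cₛ^∞⟮𝓡 n; EuclideanSpace ℝ (Fin n), (TangentSpace (𝓡 n) : M → Type _)⟯

/-- The space of smooth tensor fields of type (1,1) on an `n`-dimensional manifold `M`: the smooth
sections of the bundle `Hom(TM, TM)`. -/
abbrev SmoothTensorField11 (n : ℕ) (M : Type*) [TopologicalSpace M]
    [ChartedSpace (EuclideanSpace ℝ (Fin n)) M] [IsManifold (𝓡 n) ∞ M] : Type _ :=
  Cₛ^∞⟮𝓡 n; EuclideanSpace ℝ (Fin n) →L[ℝ] EuclideanSpace ℝ (Fin n),
    (fun x : M ↦ TangentSpace (𝓡 n) x →L[ℝ] TangentSpace (𝓡 n) x)⟯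

section Tensors

variable {n : ℕ} {M : Type*} [TopologicalSpace M] [ChartedSpace (EuclideanSpace ℝ (Fin n)) M]

/-- `Ψ² - α Ψ - β I = 0`, for the positive integers `α`, `β`. -/
def IsMetallicStructure [IsManifold (𝓡 n) ∞ M] (Ψ : SmoothTensorField11 n M) (α β : ℕ) : Prop :=
  0 < α ∧ 0 < β ∧
    ∀ (x : M) (u : TangentSpace (𝓡 n) x),
      Ψ x (Ψ x u) - (α : ℝ) • Ψ x u - (β : ℝ) • u = 0

/-- The value at `x` of the Nijenhuis tensor of a field `Ψ` of endomorphisms of the tangent spaces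
on the vector fields `X`, `Y`:
`N_Ψ(X, Y) = [ΨX, ΨY] - Ψ[ΨX, Y] - Ψ[X, ΨY] + Ψ²[X, Y]`. -/
def nijenhuis (Ψ : Π x : M, TangentSpace (𝓡 n) x →L[ℝ] TangentSpace (𝓡 n) x)
    (X Y : Π x : M, TangentSpace (𝓡 n) x) (x : M) : TangentSpace (𝓡 n) x :=
  mlieBracket (𝓡 n) (fun y ↦ Ψ y (X y)) (fun y ↦ Ψ y (Y y)) x
    - Ψ x (mlieBracket (𝓡 n) (fun y ↦ Ψ y (X y)) Y x)
    - Ψ x (mlieBracket (𝓡 n) X (fun y ↦ Ψ y (Y y)) x)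
    + Ψ x (Ψ x (mlieBracket (𝓡 n) X Y x))

/-- `N_Ψ = 0`: the Nijenhuis tensor vanishes on all smooth vector fields. -/
def NijenhuisVanishes [IsManifold (𝓡 n) ∞ M]
    (Ψ : Π x : M, TangentSpace (𝓡 n) x →L[ℝ] TangentSpace (𝓡 n) x) : Prop :=
  ∀ (X Y : SmoothVectorField n M) (x : M), nijenhuis Ψ X Y x = 0

end Tensors

/-! ### The complete lift of a tensor field of type (1,1) to the tangent bundle -/

section CompleteLift

variable {n : ℕ} {M : Type*} [TopologicalSpace M] [ChartedSpace (EuclideanSpace ℝ (Fin n)) M]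
  [IsManifold (𝓡 n) ∞ M]

/-- The matrix `Ψ^h_i` of a tensor field `Ψ` of type (1,1) in the coordinates given by the preferred
chart around `x₀`, as a function of the coordinates. -/
def localComponents (Ψ : SmoothTensorField11 n M) (x₀ : M) (z : EuclideanSpace ℝ (Fin n)) :
    EuclideanSpace ℝ (Fin n) →L[ℝ] EuclideanSpace ℝ (Fin n) :=
  let y : M := (extChartAt (𝓡 n) x₀).symm z
  ContinuousLinearMap.inCoordinates (EuclideanSpace ℝ (Fin n)) (TangentSpace (𝓡 n) : M → Type _)
    (EuclideanSpace ℝ (Fin n)) (TangentSpace (𝓡 n) : M → Type _) x₀ y x₀ y (Ψ y)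

/-- The complete lift `Ψ^C` of `Ψ` at the point `p = (x, v)` of the tangent bundle `TM`, with
matrix `[Ψ^h_i, 0; ∂Ψ^h_i, Ψ^h_i]`, where `∂ = v^k ∂_k`, in the coordinates `(x^h, y^h)` of `TM`
induced by the preferred chart of `M` around `x`. These coordinates form the preferred chart of
`TM` around `p`, through which a tangent vector of `TM` at `p` is by definition a pair `(a, b)` of
vectors of `ℝⁿ`, its components along the `x^h` and along the `y^h`. -/
def completeLift (Ψ : SmoothTensorField11 n M) (p : TangentBundle (𝓡 n) M) :
    TangentSpace (𝓡 n).tangent p →L[ℝ] TangentSpace (𝓡 n).tangent p :=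
  let E := EuclideanSpace ℝ (Fin n)
  let z : E := extChartAt (𝓡 n) p.proj p.proj
  let v : E := p.snd
  let A : E →L[ℝ] E := localComponents Ψ p.proj z
  let dA : E →L[ℝ] E := fderiv ℝ (localComponents Ψ p.proj) z v
  ((A ∘L ContinuousLinearMap.fst ℝ E E).prod
    (dA ∘L ContinuousLinearMap.fst ℝ E E + A ∘L ContinuousLinearMap.snd ℝ E E) :
      E × E →L[ℝ] E × E)

end CompleteLift

/-! ### The cross-section of the tangent bundle determined by a vector field -/

section CrossSections

variable {n : ℕ} {M : Type*} [TopologicalSpace M] [ChartedSpace (EuclideanSpace ℝ (Fin n)) M]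
  [IsManifold (𝓡 n) ∞ M]

/-- The map `β_V : M → TM`, `x ↦ (x, V x)`. -/
def crossSectionMap (V : SmoothVectorField n M) (x : M) : TangentBundle (𝓡 n) M := ⟨x, V x⟩

theorem contMDiff_crossSectionMap (V : SmoothVectorField n M) :
    ContMDiff (𝓡 n) (𝓡 n).tangent ∞ (crossSectionMap V) := V.contMDiff

/-- The cross-section `β_V(M)`, a subset of `TM`, with the subspace topology. -/
def CrossSection (V : SmoothVectorField n M) : Type _ := Set.range (crossSectionMap V)

instance (V : SmoothVectorField n M) : TopologicalSpace (CrossSection V) :=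
  inferInstanceAs (TopologicalSpace (Set.range (crossSectionMap V)))

namespace CrossSection

variable (V : SmoothVectorField n M)

/-- The inclusion of `β_V(M)` in `TM`. -/
def incl (s : CrossSection V) : TangentBundle (𝓡 n) M := s.1

theorem incl_proj (s : CrossSection V) :
    crossSectionMap V (incl V s).proj = incl V s := by
  obtain ⟨_, x, rfl⟩ := s
  rfl

/-- The homeomorphism of `M` with `β_V(M)` given by `β_V`. -/
def homeo : M ≃ₜ CrossSection V where
  toFun x := ⟨crossSectionMap V x, x, rfl⟩
  invFun s := (incl V s).proj
  left_inv _ := rfl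
  right_inv s := Subtype.ext (incl_proj V s)
  continuous_toFun := (contMDiff_crossSectionMap V).continuous.subtype_mk _
  continuous_invFun :=
    (FiberBundle.continuous_proj (EuclideanSpace ℝ (Fin n)) (TangentSpace (𝓡 n) : M → Type _)).comp
      continuous_subtype_val

/-- The smooth structure of `β_V(M)` as an `n`-dimensional submanifold of `TM`: it is parametrized
by `β_V`, so its charts are those of `M` composed with the inverse of `β_V`. -/
instance : ChartedSpace (EuclideanSpace ℝ (Fin n)) (CrossSection V) where
  atlas := (fun e ↦ (homeo V).symm.toOpenPartialHomeomorph.trans e) ''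
    atlas (EuclideanSpace ℝ (Fin n)) M
  chartAt s := (homeo V).symm.toOpenPartialHomeomorph.trans
    (chartAt (EuclideanSpace ℝ (Fin n)) ((homeo V).symm s))
  mem_chart_source s := by simp
  chart_mem_atlas s := ⟨_, chart_mem_atlas _ _, rfl⟩

instance : IsManifold (𝓡 n) ∞ (CrossSection V) where
  compatible := by
    rintro _ _ ⟨e, he, rfl⟩ ⟨f, hf, rfl⟩
    have h := (contDiffGroupoid ∞ (𝓡 n)).compatible he hf
    convert h using 1
    ext x <;> simp

/-- `β_V : M → β_V(M)` is smooth. -/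
theorem contMDiff_homeo : ContMDiff (𝓡 n) (𝓡 n) ∞ (homeo V) := by
  intro x
  have h1 := (contMDiffOn_chart (I := 𝓡 n) (n := ∞) (x := x)).contMDiffAt
    ((chartAt (EuclideanSpace ℝ (Fin n)) x).open_source.mem_nhds (mem_chart_source _ x))
  have h2 := (contMDiffOn_chart_symm (I := 𝓡 n) (n := ∞) (x := homeo V x)).contMDiffAt
    ((chartAt (EuclideanSpace ℝ (Fin n)) (homeo V x)).open_target.mem_nhds
      (mem_chart_target _ (homeo V x)))
  refine (ContMDiffAt.comp x h2 h1).congr_of_eventuallyEq ?_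
  filter_upwards [(chartAt (EuclideanSpace ℝ (Fin n)) x).open_source.mem_nhds
    (mem_chart_source _ x)] with y hy
  exact congrArg (homeo V) ((chartAt (EuclideanSpace ℝ (Fin n)) x).left_inv hy).symm

/-- The inverse `β_V(M) → M` of `β_V` is smooth. -/
theorem contMDiff_homeo_symm : ContMDiff (𝓡 n) (𝓡 n) ∞ (homeo V).symm := by
  intro s
  have h1 := (contMDiffOn_chart (I := 𝓡 n) (n := ∞) (x := s)).contMDiffAt
    ((chartAt (EuclideanSpace ℝ (Fin n)) s).open_source.mem_nhds (mem_chart_source _ s))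
  have h2 := (contMDiffOn_chart_symm (I := 𝓡 n) (n := ∞) (x := (homeo V).symm s)).contMDiffAt
    ((chartAt (EuclideanSpace ℝ (Fin n)) ((homeo V).symm s)).open_target.mem_nhds
      (mem_chart_target _ ((homeo V).symm s)))
  refine (ContMDiffAt.comp s h2 h1).congr_of_eventuallyEq ?_
  filter_upwards [(chartAt (EuclideanSpace ℝ (Fin n)) s).open_source.mem_nhds
    (mem_chart_source _ s)] with y hy
  have hy' : (homeo V).symm y ∈
      (chartAt (EuclideanSpace ℝ (Fin n)) ((homeo V).symm s)).source :=
    hy.2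
  exact ((chartAt (EuclideanSpace ℝ (Fin n)) ((homeo V).symm s)).left_inv hy').symm

/-- The inclusion of `β_V(M)` in `TM` is smooth. -/
theorem contMDiff_incl : ContMDiff (𝓡 n) (𝓡 n).tangent ∞ (incl V) := by
  have h : incl V = crossSectionMap V ∘ (homeo V).symm := funext fun s ↦ (incl_proj V s).symm
  rw [h]
  exact (contMDiff_crossSectionMap V).comp (contMDiff_homeo_symm V)

/-- The differential at `s` of the inclusion of `β_V(M)` in `TM`. -/
def dIncl (s : CrossSection V) :
    TangentSpace (𝓡 n) s →L[ℝ] TangentSpace (𝓡 n).tangent (incl V s) :=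
  mfderiv (𝓡 n) (𝓡 n).tangent (incl V) s

/-- The inclusion of `β_V(M)` in `TM` is an immersion. -/
theorem dIncl_injective (s : CrossSection V) : Function.Injective (dIncl V s) := by
  have hi : MDifferentiableAt (𝓡 n) (𝓡 n).tangent (incl V) s :=
    (contMDiff_incl V).mdifferentiable (by simp) s
  have hp : MDifferentiableAt (𝓡 n).tangent (𝓡 n)
      (Bundle.TotalSpace.proj : TangentBundle (𝓡 n) M → M) (incl V s) :=
    (Bundle.contMDiff_proj (n := ∞) (TangentSpace (𝓡 n) : M → Type _)).mdifferentiable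
      (by simp) _
  have hh : MDifferentiableAt (𝓡 n) (𝓡 n) (homeo V) (incl V s).proj :=
    (contMDiff_homeo V).mdifferentiable (by simp) _
  have hid : (homeo V ∘ (Bundle.TotalSpace.proj : TangentBundle (𝓡 n) M → M)) ∘ incl V = id :=
    funext fun s ↦ (homeo V).right_inv s
  have h := mfderiv_comp s (MDifferentiableAt.comp (incl V s) hh hp) hi
  rw [hid, mfderiv_id] at h
  exact Function.LeftInverse.injective fun u ↦ (DFunLike.congr_fun h u).symm

end CrossSection

/-! ### The tensor field induced on the cross-section -/

variable (Ψ : SmoothTensorField11 n M) (V : SmoothVectorField n M)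

/-- `Ψ^C` leaves `β_V(M)` invariant: it maps the vectors tangent to `β_V(M)` to vectors tangent to
`β_V(M)`. -/
def LeavesInvariant : Prop :=
  ∀ (s : CrossSection V) (w : TangentSpace (𝓡 n) s),
    completeLift Ψ (CrossSection.incl V s) (CrossSection.dIncl V s w) ∈
      (CrossSection.dIncl V s).range

/-- The tensor field `Ψ^{C#}` of type (1,1) induced on `β_V(M)` from `Ψ^C`, when `Ψ^C` leaves
`β_V(M)` invariant: the restriction of `Ψ^C` to the vectors tangent to `β_V(M)`. -/
def inducedTensor (h : LeavesInvariant Ψ V) (s : CrossSection V) :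
    TangentSpace (𝓡 n) s →L[ℝ] TangentSpace (𝓡 n) s :=
  let E := EuclideanSpace ℝ (Fin n)
  let f : E →ₗ[ℝ] E × E := (CrossSection.dIncl V s).toLinearMap
  let g : E × E →ₗ[ℝ] E × E := (completeLift Ψ (CrossSection.incl V s)).toLinearMap
  (((LinearEquiv.ofInjective f (CrossSection.dIncl_injective V s)).symm.toLinearMap ∘ₗ
    (g ∘ₗ f).codRestrict f.range (h s)).toContinuousLinearMap : E →L[ℝ] E)

/-- `Ψ^{C#}` is determined by `B(Ψ^{C#} w) = Ψ^C (B w)`, where `B` is the differential of the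
inclusion of `β_V(M)` in `TM`. -/
theorem dIncl_inducedTensor (h : LeavesInvariant Ψ V) (s : CrossSection V)
    (w : TangentSpace (𝓡 n) s) :
    CrossSection.dIncl V s (inducedTensor Ψ V h s w) =
      completeLift Ψ (CrossSection.incl V s) (CrossSection.dIncl V s w) := by
  let E := EuclideanSpace ℝ (Fin n)
  let f : E →ₗ[ℝ] E × E := (CrossSection.dIncl V s).toLinearMap
  let e := LinearEquiv.ofInjective f (CrossSection.dIncl_injective V s)
  exact congrArg Subtype.val (e.apply_symm_apply
    ⟨completeLift Ψ (CrossSection.incl V s) (CrossSection.dIncl V s w), h s w⟩)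

end CrossSections

end

/-! The projection `TM → M` restricts to a diffeomorphism from the cross-section onto `M`, with
inverse `β_V`. In induced coordinates its differential is `(a, b) ↦ a`, and the first row of the
matrix of `Ψ^C` is `(Ψ, 0)`; so the differential of the projection carries `Ψ^C` to `Ψ`
(`mfderiv_proj_completeLift`), whatever the block `∂Ψ` is. Restricting to tangent vectors of the
cross-section, this diffeomorphism intertwines `Ψ^{C#}` and `Ψ`
(`mfderiv_homeo_symm_inducedTensor`). The Nijenhuis tensor is built from Lie brackets and the
endomorphism field alone, and both are natural under diffeomorphisms (`nijenhuis_mpullback`), so the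
two tensors vanish together. -/

section CompleteLiftProjection

variable {n : ℕ} {M : Type*} [TopologicalSpace M] [ChartedSpace (EuclideanSpace ℝ (Fin n)) M]
  [IsManifold (𝓡 n) ∞ M]

theorem mdifferentiableAt_tangentBundle_proj (p : TangentBundle (𝓡 n) M) :
    MDifferentiableAt (𝓡 n).tangent (𝓡 n)
      (Bundle.TotalSpace.proj : TangentBundle (𝓡 n) M → M) p :=
  (Bundle.contMDiff_proj (n := ∞) (TangentSpace (𝓡 n) : M → Type _)).mdifferentiable
    (by simp) _

/-- In the preferred charts, the differential of the projection `TM → M` is `(a, b) ↦ a`. -/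
theorem mfderiv_tangentBundle_proj_apply (p : TangentBundle (𝓡 n) M)
    (w : EuclideanSpace ℝ (Fin n) × EuclideanSpace ℝ (Fin n)) :
    (mfderiv (𝓡 n).tangent (𝓡 n) (Bundle.TotalSpace.proj : TangentBundle (𝓡 n) M → M) p :
      EuclideanSpace ℝ (Fin n) × EuclideanSpace ℝ (Fin n) →L[ℝ] EuclideanSpace ℝ (Fin n)) w
      = w.1 := by
  have hp := mdifferentiableAt_tangentBundle_proj p
  -- The first component of the induced chart of `TM` is the chart of `M` applied to the base point,
  -- so in charts the projection is literally `Prod.fst` near the point.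
  have hev : writtenInExtChartAt (𝓡 n).tangent (𝓡 n) p
      (Bundle.TotalSpace.proj : TangentBundle (𝓡 n) M → M)
      =ᶠ[nhds (extChartAt (𝓡 n).tangent p p)] Prod.fst := by
    filter_upwards [extChartAt_target_mem_nhds (I := (𝓡 n).tangent) p] with z hz
    have h := congrArg Prod.fst ((extChartAt (𝓡 n).tangent p).right_inv hz)
    simpa [writtenInExtChartAt, extChartAt, TangentBundle.coe_chartAt_fst] using h
  have h : HasFDerivAt (writtenInExtChartAt (𝓡 n).tangent (𝓡 n) p
      (Bundle.TotalSpace.proj : TangentBundle (𝓡 n) M → M))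
      (ContinuousLinearMap.fst ℝ (EuclideanSpace ℝ (Fin n)) (EuclideanSpace ℝ (Fin n)))
      (extChartAt (𝓡 n).tangent p p) :=
    hasFDerivAt_fst.congr_of_eventuallyEq hev
  have h' : HasMFDerivAt (𝓡 n).tangent (𝓡 n)
      (Bundle.TotalSpace.proj : TangentBundle (𝓡 n) M → M) p
      (ContinuousLinearMap.fst ℝ (EuclideanSpace ℝ (Fin n)) (EuclideanSpace ℝ (Fin n))) :=
    ⟨hp.continuousAt, h.hasFDerivWithinAt⟩
  rw [h'.mfderiv]
  rfl

/-- The trivialization of `TM` attached to the chart at `x` is the identity on the fibre over `x`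
itself. This identifies the diagonal blocks of `Ψ^C` with `Ψ`. -/
theorem localComponents_self (Ψ : SmoothTensorField11 n M) (x : M) :
    localComponents Ψ x (extChartAt (𝓡 n) x x) = Ψ x := by
  -- Going to the chart and back returns `x` only propositionally, and the type of `Ψ y` depends on
  -- `y`; a free `y` allows substitution.
  have key : ∀ y : M, y = x → ContinuousLinearMap.inCoordinates (EuclideanSpace ℝ (Fin n))
      (TangentSpace (𝓡 n) : M → Type _) (EuclideanSpace ℝ (Fin n))
      (TangentSpace (𝓡 n) : M → Type _) x y x y (Ψ y) =
        (Ψ x : EuclideanSpace ℝ (Fin n) →L[ℝ] EuclideanSpace ℝ (Fin n)) := by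
    rintro y rfl
    have h := (tangentBundleCore (𝓡 n) M).inCoordinates_eq (tangentBundleCore (𝓡 n) M) (Ψ y)
      (mem_chart_source _ y) (mem_chart_source _ y)
    refine h.trans (ContinuousLinearMap.ext fun u ↦ ?_)
    have hs := mem_extChartAt_source (I := 𝓡 n) y
    exact (tangentCoordChange_self hs).trans
      (congrArg (Ψ y) (tangentCoordChange_self (v := u) hs))
  exact key _ (extChartAt_to_inv x)

/-- The complete lift `Ψ^C` is projectable onto `Ψ`. -/
theorem mfderiv_proj_completeLift (Ψ : SmoothTensorField11 n M) (p : TangentBundle (𝓡 n) M)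
    (w : TangentSpace (𝓡 n).tangent p) :
    mfderiv (𝓡 n).tangent (𝓡 n) (Bundle.TotalSpace.proj : TangentBundle (𝓡 n) M → M) p
        (completeLift Ψ p w) =
      Ψ p.proj (mfderiv (𝓡 n).tangent (𝓡 n)
        (Bundle.TotalSpace.proj : TangentBundle (𝓡 n) M → M) p w) := by
  refine (mfderiv_tangentBundle_proj_apply p _).trans ?_
  refine Eq.trans ?_ (congrArg (Ψ p.proj) (mfderiv_tangentBundle_proj_apply p w)).symm
  exact DFunLike.congr_fun (localComponents_self Ψ p.proj)
    (w : EuclideanSpace ℝ (Fin n) × EuclideanSpace ℝ (Fin n)).1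

end CompleteLiftProjection

section InvertibleDifferential

variable {n : ℕ} {M N : Type*} [TopologicalSpace M] [ChartedSpace (EuclideanSpace ℝ (Fin n)) M]
  [TopologicalSpace N] [ChartedSpace (EuclideanSpace ℝ (Fin n)) N]

/-- The chain rule applied to both composites makes the differential of `g` a two-sided inverse. -/
theorem isInvertible_mfderiv_of_comp_eq_id {f : N → M} {g : M → N}
    (hf : MDifferentiable (𝓡 n) (𝓡 n) f) (hg : MDifferentiable (𝓡 n) (𝓡 n) g)
    (hfg : f ∘ g = id) (hgf : g ∘ f = id) (x : N) :
    (mfderiv (𝓡 n) (𝓡 n) f x).IsInvertible := by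
  have h1 : MDifferentiableAt (𝓡 n) (𝓡 n) g (f x) := hg _
  have hx : g (f x) = x := congrFun hgf x
  have h2 := mfderiv_comp x h1 (hf x)
  have h3 := mfderiv_comp_of_eq (x := f x) (y := x) (hf x) h1 hx
  rw [hgf, mfderiv_id] at h2
  rw [hfg, mfderiv_id] at h3
  -- The chain rule for `f ∘ g` yields the differential of `f` at `g (f x)`; it is compared with the
  -- one at `x` as a map of the model space.
  have h4 : ∀ z : N, z = x →
      (mfderiv (𝓡 n) (𝓡 n) f z : EuclideanSpace ℝ (Fin n) →L[ℝ] EuclideanSpace ℝ (Fin n)) =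
        mfderiv (𝓡 n) (𝓡 n) f x := by
    rintro _ rfl
    rfl
  have h5 := congrArg (fun A : EuclideanSpace ℝ (Fin n) →L[ℝ] EuclideanSpace ℝ (Fin n) ↦
    A ∘L (mfderiv (𝓡 n) (𝓡 n) g (f x) :
      EuclideanSpace ℝ (Fin n) →L[ℝ] EuclideanSpace ℝ (Fin n))) (h4 _ hx)
  exact ContinuousLinearMap.IsInvertible.of_inverse (h5.symm.trans h3.symm) h2.symm

end InvertibleDifferential

section NijenhuisNaturality

variable {n : ℕ} {M N : Type*} [TopologicalSpace M] [ChartedSpace (EuclideanSpace ℝ (Fin n)) M]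
  [IsManifold (𝓡 n) ∞ M] [TopologicalSpace N] [ChartedSpace (EuclideanSpace ℝ (Fin n)) N]
  [IsManifold (𝓡 n) ∞ N]

theorem SmoothTensorField11.contMDiff_apply (Ψ : SmoothTensorField11 n M)
    (X : SmoothVectorField n M) :
    ContMDiff (𝓡 n) (𝓡 n).tangent ∞ (fun x ↦ (⟨x, Ψ x (X x)⟩ : TangentBundle (𝓡 n) M)) :=
  fun x ↦ ContMDiffAt.clm_bundle_apply (Ψ.contMDiff x) (X.contMDiff x)

/-- The pull-back of a smooth vector field by a diffeomorphism. -/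
noncomputable def SmoothVectorField.pullback (f : N → M) (hf : ContMDiff (𝓡 n) (𝓡 n) ∞ f)
    (hf' : ∀ x, (mfderiv (𝓡 n) (𝓡 n) f x).IsInvertible) (X : SmoothVectorField n M) :
    SmoothVectorField n N :=
  ⟨mpullback (𝓡 n) (𝓡 n) f X,
    ContMDiff.mpullback_vectorField (n := ∞) X.contMDiff hf hf' (by simp)⟩

/-- A diffeomorphism that intertwines two tensor fields of type (1,1) intertwines their Nijenhuis
tensors. -/
theorem nijenhuis_mpullback {f : N → M} (hf : ContMDiff (𝓡 n) (𝓡 n) ∞ f)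
    (hf' : ∀ x, (mfderiv (𝓡 n) (𝓡 n) f x).IsInvertible)
    (Ψ : SmoothTensorField11 n M) (Φ : Π x : N, TangentSpace (𝓡 n) x →L[ℝ] TangentSpace (𝓡 n) x)
    (hΦ : ∀ x w, mfderiv (𝓡 n) (𝓡 n) f x (Φ x w) = Ψ (f x) (mfderiv (𝓡 n) (𝓡 n) f x w))
    (X Y : SmoothVectorField n M) (x : N) :
    nijenhuis Φ (mpullback (𝓡 n) (𝓡 n) f X) (mpullback (𝓡 n) (𝓡 n) f Y) x =
      mpullback (𝓡 n) (𝓡 n) f (nijenhuis (fun y ↦ Ψ y) X Y) x := by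
  have hcomm : ∀ (y : N) (u : TangentSpace (𝓡 n) (f y)),
      Φ y ((mfderiv (𝓡 n) (𝓡 n) f y).inverse u) =
        (mfderiv (𝓡 n) (𝓡 n) f y).inverse (Ψ (f y) u) := by
    intro y u
    apply (hf' y).injective
    rw [hΦ, (hf' y).self_apply_inverse, (hf' y).self_apply_inverse]
  -- Regularity of `Φ` is needed only through this identity, which turns each bracket on `N` into a
  -- bracket of pull-backs of differentiable fields on `M`.
  have hfield : ∀ Z : SmoothVectorField n M,
      (fun y ↦ Φ y (mpullback (𝓡 n) (𝓡 n) f Z y)) =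
        mpullback (𝓡 n) (𝓡 n) f (fun y ↦ Ψ y (Z y)) :=
    fun Z ↦ funext fun y ↦ hcomm y (Z (f y))
  have hd : ∀ Z : SmoothVectorField n M, MDifferentiableAt (𝓡 n) (𝓡 n).tangent
      (fun y ↦ (⟨y, Z y⟩ : TangentBundle (𝓡 n) M)) (f x) :=
    fun Z ↦ Z.contMDiff.mdifferentiable (by simp) _
  have hdΨ : ∀ Z : SmoothVectorField n M, MDifferentiableAt (𝓡 n) (𝓡 n).tangent
      (fun y ↦ (⟨y, Ψ y (Z y)⟩ : TangentBundle (𝓡 n) M)) (f x) :=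
    fun Z ↦ (Ψ.contMDiff_apply Z).mdifferentiable (by simp) _
  have h2 : minSmoothness ℝ 2 ≤ (∞ : WithTop ℕ∞) := by
    rw [minSmoothness_of_isRCLikeNormedField]
    exact WithTop.coe_le_coe.2 le_top
  have : IsManifold (𝓡 n) (minSmoothness ℝ 2) M := IsManifold.of_le h2
  have : IsManifold (𝓡 n) (minSmoothness ℝ 2) N := IsManifold.of_le h2
  unfold nijenhuis
  rw [hfield X, hfield Y,
    ← mpullback_mlieBracket (hdΨ X) (hdΨ Y) (hf x) h2,
    ← mpullback_mlieBracket (hdΨ X) (hd Y) (hf x) h2,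
    ← mpullback_mlieBracket (hd X) (hdΨ Y) (hf x) h2,
    ← mpullback_mlieBracket (hd X) (hd Y) (hf x) h2]
  simp only [mpullback_apply, hcomm, map_add, map_sub]

/-- The vanishing of the Nijenhuis tensor is invariant under diffeomorphisms. -/
theorem nijenhuisVanishes_iff_of_diffeomorph {f : N → M} {g : M → N}
    (hf : ContMDiff (𝓡 n) (𝓡 n) ∞ f) (hg : ContMDiff (𝓡 n) (𝓡 n) ∞ g)
    (hfg : f ∘ g = id) (hgf : g ∘ f = id)
    (Ψ : SmoothTensorField11 n M) (Φ : Π x : N, TangentSpace (𝓡 n) x →L[ℝ] TangentSpace (𝓡 n) x)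
    (hΦ : ∀ x w, mfderiv (𝓡 n) (𝓡 n) f x (Φ x w) = Ψ (f x) (mfderiv (𝓡 n) (𝓡 n) f x w)) :
    NijenhuisVanishes Φ ↔ NijenhuisVanishes (fun x ↦ Ψ x) := by
  have hdf : MDifferentiable (𝓡 n) (𝓡 n) f := hf.mdifferentiable (by simp)
  have hdg : MDifferentiable (𝓡 n) (𝓡 n) g := hg.mdifferentiable (by simp)
  have hf' := isInvertible_mfderiv_of_comp_eq_id hdf hdg hfg hgf
  have hg' := isInvertible_mfderiv_of_comp_eq_id hdg hdf hgf hfg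
  constructor
  · intro h X Y x
    obtain ⟨y, rfl⟩ : ∃ y, f y = x := ⟨g x, congrFun hfg x⟩
    have hy := (nijenhuis_mpullback hf hf' Ψ Φ hΦ X Y y).symm.trans
      (h (X.pullback f hf hf') (Y.pullback f hf hf') y)
    rw [mpullback_apply] at hy
    rw [← (hf' y).self_apply_inverse (nijenhuis (fun y ↦ Ψ y) X Y (f y)), hy, map_zero]
  · intro h X Y y
    -- Since `g ∘ f = id`, every smooth field on `N` is the pull-back by `f` of a smooth field on
    -- `M`, so testing on pull-backs suffices.
    have hpull : ∀ Z : SmoothVectorField n N,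
        mpullback (𝓡 n) (𝓡 n) f (Z.pullback g hg hg') = Z := fun Z ↦ by
      funext z
      have hc := mpullbackWithin_comp_of_left (I := 𝓡 n) (I' := 𝓡 n) (I'' := 𝓡 n) (g := g) (f := f)
        (V := Z) (s := Set.univ) (t := Set.univ) (x₀ := z) (hdf z).mdifferentiableWithinAt
        (Set.mapsTo_univ _ _) (uniqueMDiffWithinAt_univ _)
        (by rw [mfderivWithin_univ]; exact hg' _)
      rw [hgf] at hc
      simp only [mpullbackWithin_univ, mpullback_id] at hc
      exact hc.symm
    have hy := nijenhuis_mpullback hf hf' Ψ Φ hΦ (X.pullback g hg hg') (Y.pullback g hg hg') y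
    rw [hpull, hpull, mpullback_apply, h, map_zero] at hy
    exact hy

end NijenhuisNaturality

section InducedTensor

variable {n : ℕ} {M : Type*} [TopologicalSpace M] [ChartedSpace (EuclideanSpace ℝ (Fin n)) M]
  [IsManifold (𝓡 n) ∞ M]

/-- The projection `β_V(M) → M` intertwines `Ψ^{C#}` and `Ψ`. -/
theorem mfderiv_homeo_symm_inducedTensor (Ψ : SmoothTensorField11 n M)
    (V : SmoothVectorField n M) (h : LeavesInvariant Ψ V) (s : CrossSection V)
    (w : TangentSpace (𝓡 n) s) :
    mfderiv (𝓡 n) (𝓡 n) (CrossSection.homeo V).symm s (inducedTensor Ψ V h s w) =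
      Ψ ((CrossSection.homeo V).symm s)
        (mfderiv (𝓡 n) (𝓡 n) (CrossSection.homeo V).symm s w) := by
  -- By definition `(homeo V).symm` is the bundle projection composed with `incl V`; this is the
  -- chain rule.
  have hD : ∀ u : TangentSpace (𝓡 n) s,
      mfderiv (𝓡 n) (𝓡 n) (CrossSection.homeo V).symm s u =
        mfderiv (𝓡 n).tangent (𝓡 n) (Bundle.TotalSpace.proj : TangentBundle (𝓡 n) M → M)
          (CrossSection.incl V s) (CrossSection.dIncl V s u) := fun u ↦
    DFunLike.congr_fun (mfderiv_comp s (mdifferentiableAt_tangentBundle_proj _)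
      ((CrossSection.contMDiff_incl V).mdifferentiable (by simp) s)) u
  rw [hD, hD, dIncl_inducedTensor]
  exact mfderiv_proj_completeLift Ψ _ _

end InducedTensor

theorem theorem6p4 {n : ℕ} {M : Type*} [TopologicalSpace M] [T2Space M]
    [ChartedSpace (EuclideanSpace ℝ (Fin n)) M] [IsManifold (𝓡 n) ∞ M]
    (Ψ : SmoothTensorField11 n M) (α β : ℕ) (hΨ : IsMetallicStructure Ψ α β)
    (V : SmoothVectorField n M) (hinv : LeavesInvariant Ψ V) :
    NijenhuisVanishes (inducedTensor Ψ V hinv) ↔ NijenhuisVanishes (fun x ↦ Ψ x) := by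
  exact nijenhuisVanishes_iff_of_diffeomorph (CrossSection.contMDiff_homeo_symm V)
    (CrossSection.contMDiff_homeo V) (CrossSection.homeo V).symm_comp_self
    (CrossSection.homeo V).self_comp_symm Ψ _ (mfderiv_homeo_symm_inducedTensor Ψ V hinv)
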